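/- Let $H_1=\mathbb R^3$ be the Heisenberg group with the left invariant fields $\mathring e_1=\partial_x+y\,\partial_z$, $\mathring e_2=\partial_y-x\,\partial_z$, $T=\partial_z$, the contact form $\Theta=dz+x\,dy-y\,dx$, the contact bundle $\xi=\ker\Theta$, the CR structure $J\mathring e_1=\mathring e_2$, $J\mathring e_2=-\mathring e_1$ on $\xi$, the adapted metric for which $\mathring e_1,\mathring e_2,T$ are orthonormal, and the connection $\nabla$ for which $\mathring e_1,\mathring e_2,T$ are parallel. A Heisenberg rigid motion is a smooth diffeomorphism of $H_1$ preserving $\Theta$ and $J$. A point of a surface $\Sigma\subset H_1$ is regular if $T_p\Sigma\neq\xi_p$; near such points let $e_1$ be a smooth unit field in $T\Sigma\cap\xi$ and $e_2=Je_1$. The $p$-mean curvature $H$ is defined by $\nabla_{e_1}e_2=-He_1$; $\Sigma$ is $p$-minimal if $H=0$ on its regular part. The $\alpha$-function is defined by $\alpha e_2+T\in T\Sigma$. Let $X:U\to H_1$ be a smooth embedding of an open set $U\subset\mathbb R^2$ with coordinates $(x,y)$ such that $\Sigma=X(U)$ is $p$-minimal and has only regular points. Given functions $\zeta_1,\zeta_2$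 of $y$, we say that $\Sigma$ is of special type I, of special type II, or of general type, with $(x,y)$ as a normal coordinate system and with $\zeta_1$ as its $\zeta_1$-invariant (for the general type: $\zeta_1,\zeta_2$ as its $\zeta_1$- and $\zeta_2$-invariants), if on $U$ one has $e_1=\partial/\partial x$ and $\frac{\alpha e_2+T}{\sqrt{1+\alpha^2}}=b\,\frac{\partial}{\partial y}$, where the denominators in the formula for $\alpha$ do not vanish on $U$ and, respectively, (I) $\alpha=\dfrac1{x+\zeta_1(y)}$ and $b=\dfrac{\alpha^2}{\sqrt{1+\alpha^2}}$; (II) $\alpha=\dfrac1{2x+\zeta_1(y)}$ and $b=\dfrac{|\alpha|}{\sqrt{1+\alpha^2}}$; (general) $\alpha=\dfrac{x+\zeta_1(y)}{(x+\zeta_1(y))^2+\zeta_2(y)}$ and $b=\dfrac1{|(x+\zeta_1(y))^2+\zeta_2(y)|\sqrt{1+\alpha^2}}$ (which equals $\frac{|\alpha|}{|x+\zeta_1(y)|\sqrt{1+\alpha^2}}$ where $x+\zeta_1(y)\ne0$). **Theorem.** Let $(c,d)\subset\mathbb R$ be a nonempty open interval, possibly unbounded, and let $\zeta_1,\zeta_2$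 be smooth functions on $(c,d)$ with $\zeta_2(y)\neq0$ for all $y\in(c,d)$. 1. For each of the three types and every compact interval $[c',d']\subset(c,d)$ there are an interval $(e,f)\subset\mathbb R$, a connected open set $U\subset(e,f)\times(c,d)$ whose projection to the $y$-axis contains $[c',d']$, and a smooth embedding $X:U\to H_1$ such that $\Sigma=X(U)$ is a $p$-minimal surface of that type with $(x,y)$ as a normal coordinate system and $\zeta_1$ as its $\zeta_1$-invariant (for the general type: $\zeta_1$ and $\zeta_2$ as its $\zeta_1$- and $\zeta_2$-invariants). 2. Such embeddings are unique up to a Heisenberg rigid motion: if $U\subset\mathbb R\times(c,d)$ is open and connected, and $X,Y:U\to H_1$ are two embeddings as in 1 for the same type and the same $\zeta_1$ (and $\zeta_2$, for the general type), then $Y=\Phi\circ X$ on $U$ for some Heisenberg rigid motion $\Phi$. -/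

import Mathlib

open scoped ContDiff

namespace Heisenberg

/-- The space underlying the Heisenberg group `H₁`, with coordinates `(x, y, z)`; the tangent space
at every point is identified with the space itself. -/
abbrev H1 : Type := ℝ × ℝ × ℝ

/-- The left invariant field `∂/∂x + y ∂/∂z`. -/
def frame1 (p : H1) : H1 := (1, 0, p.2.1)

/-- The left invariant field `∂/∂y - x ∂/∂z`. -/
def frame2 (p : H1) : H1 := (0, 1, -p.1)

/-- The left invariant field `T = ∂/∂z`. -/
def frameT (_p : H1) : H1 := (0, 0, 1)

/-- The contact form `Θ = dz + x dy - y dx` at `p`. -/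
def contactForm (p : H1) : H1 →ₗ[ℝ] ℝ where
  toFun v := v.2.2 + p.1 * v.2.1 - p.2.1 * v.1
  map_add' v w := by simp; ring
  map_smul' r v := by simp; ring

/-- The contact plane `ξ` at `p`, the kernel of `Θ`. It is spanned by `frame1 p` and `frame2 p`. -/
def contactPlane (p : H1) : Submodule ℝ H1 := LinearMap.ker (contactForm p)

/-- The CR structure `J` at `p`. A vector `v` of the contact plane equals
`v.1 • frame1 p + v.2.1 • frame2 p`, and `J` sends `frame1` to `frame2` and `frame2` to `-frame1`.
It is only ever applied to vectors of the contact plane. -/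
def J (p : H1) (v : H1) : H1 := v.1 • frame2 p - v.2.1 • frame1 p

/-- The adapted metric: `frame1`, `frame2`, `frameT` are orthonormal. A vector `v` at `p` equals
`v.1 • frame1 p + v.2.1 • frame2 p + contactForm p v • frameT p`. -/
def metric (p : H1) (v w : H1) : ℝ :=
  v.1 * w.1 + v.2.1 * w.2.1 + contactForm p v * contactForm p w

/-- Heisenberg rigid motions: smooth diffeomorphisms of `H₁` that preserve `Θ` and `J`. -/
structure IsRigidMotion (Φ : H1 ≃ H1) : Prop where
  smooth : ContDiff ℝ ∞ Φ
  smooth_symm : ContDiff ℝ ∞ Φ.symm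
  map_contactForm : ∀ p v, contactForm (Φ p) (fderiv ℝ Φ p v) = contactForm p v
  map_J : ∀ p, ∀ v ∈ contactPlane p, fderiv ℝ Φ p (J p v) = J (Φ p) (fderiv ℝ Φ p v)

/-- `X` restricted to the open set `U` is a smooth embedding into `H₁`. -/
structure IsSmoothEmbeddingOn (X : ℝ × ℝ → H1) (U : Set (ℝ × ℝ)) : Prop where
  smooth : ContDiffOn ℝ ∞ X U
  immersion : ∀ q ∈ U, Function.Injective (fderiv ℝ X q)
  embedding : Topology.IsEmbedding (U.domRestrict X)

/-- The tangent plane of the parametrized surface `X` at the parameter `q`. -/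
noncomputable def tangentPlane (X : ℝ × ℝ → H1) (q : ℝ × ℝ) : Submodule ℝ H1 :=
  LinearMap.range (fderiv ℝ X q : ℝ × ℝ →ₗ[ℝ] H1)

/-- `q` is a regular point of the surface: the tangent plane is not the contact plane. -/
def IsRegularPoint (X : ℝ × ℝ → H1) (q : ℝ × ℝ) : Prop :=
  tangentPlane X q ≠ contactPlane (X q)

/-- The vector field along `X` that is the push-forward of the field `E` on the parameter domain. -/
noncomputable def push (X : ℝ × ℝ → H1) (E : ℝ × ℝ → ℝ × ℝ) (q : ℝ × ℝ) : H1 := fderiv ℝ X q (E q)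

/-- `E` is (in the parameter domain) a characteristic direction `e₁` on `V`: a smooth field whose
push-forward is a unit vector field in the intersection of tangent plane and contact plane, and all
points of `V` are regular. -/
structure IsCharacteristicField (X : ℝ × ℝ → H1) (V : Set (ℝ × ℝ)) (E : ℝ × ℝ → ℝ × ℝ) :
    Prop where
  regular : ∀ q ∈ V, IsRegularPoint X q
  smooth : ContDiffOn ℝ ∞ E V
  horizontal : ∀ q ∈ V, push X E q ∈ contactPlane (X q)
  unit : ∀ q ∈ V, metric (X q) (push X E q) (push X E q) = 1

/-- The horizontal normal `e₂ = J e₁`, as a field along `X`. -/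
noncomputable def horizontalNormal (X : ℝ × ℝ → H1) (E : ℝ × ℝ → ℝ × ℝ) (q : ℝ × ℝ) : H1 :=
  J (X q) (push X E q)

/-- The covariant derivative at `q`, in the direction `v` of the parameter domain, of the field `W`
along `X`, for the connection of `H₁` in which `frame1`, `frame2`, `frameT` are parallel: the
components of `W` with respect to this frame are differentiated. -/
noncomputable def covDeriv (X : ℝ × ℝ → H1) (W : ℝ × ℝ → H1) (q v : ℝ × ℝ) : H1 :=
  (fderiv ℝ (fun s => (W s).1) q v) • frame1 (X q)
    + (fderiv ℝ (fun s => (W s).2.1) q v) • frame2 (X q)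
    + (fderiv ℝ (fun s => contactForm (X s) (W s)) q v) • frameT (X q)

/-- `H` is the `p`-mean curvature on `V` with respect to `e₁`: `∇_{e₁} e₂ = -H e₁`. -/
def HasPMeanCurvature (X : ℝ × ℝ → H1) (V : Set (ℝ × ℝ)) (E : ℝ × ℝ → ℝ × ℝ)
    (H : ℝ × ℝ → ℝ) : Prop :=
  ∀ q ∈ V, covDeriv X (horizontalNormal X E) q (E q) = -(H q) • push X E q

/-- The surface is `p`-minimal: `H = 0` on the regular part. The direction `e₁` exists locally, up
to sign, near every regular point. -/
def IsPMinimal (X : ℝ × ℝ → H1) (U : Set (ℝ × ℝ)) : Prop :=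
  ∀ V ⊆ U, IsOpen V → ∀ E, IsCharacteristicField X V E → HasPMeanCurvature X V E 0

/-- `α` is the `α`-function with respect to `e₁`: `α e₂ + T` is tangent to the surface. -/
def IsAlphaFunction (X : ℝ × ℝ → H1) (U : Set (ℝ × ℝ)) (E : ℝ × ℝ → ℝ × ℝ)
    (α : ℝ × ℝ → ℝ) : Prop :=
  ∀ q ∈ U, α q • horizontalNormal X E q + frameT (X q) ∈ tangentPlane X q

/-- The pair `a, b` represents the induced metric:
`(α e₂ + T) / √(1 + α²) = a ∂/∂x + b ∂/∂y`, the right side being pushed forward by `X`. -/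
def IsMetricRepresentation (X : ℝ × ℝ → H1) (U : Set (ℝ × ℝ)) (E : ℝ × ℝ → ℝ × ℝ)
    (α a b : ℝ × ℝ → ℝ) : Prop :=
  ∀ q ∈ U, (1 / √(1 + α q ^ 2)) • (α q • horizontalNormal X E q + frameT (X q))
    = fderiv ℝ X q (a q, b q)

/-- The coordinate field `∂/∂x` of the parameter domain. -/
def partialX : ℝ × ℝ → ℝ × ℝ := fun _ => (1, 0)

/-- The three types of nonvertical `p`-minimal surfaces. -/
inductive SurfaceType
  | specialI
  | specialII
  | general

namespace SurfaceType

/-- The denominator of the `α`-function of each type. The function `c₂` is used only for the general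
type. -/
def denom (τ : SurfaceType) (c₁ c₂ : ℝ → ℝ) (q : ℝ × ℝ) : ℝ :=
  match τ with
  | specialI => q.1 + c₁ q.2
  | specialII => 2 * q.1 + c₁ q.2
  | general => (q.1 + c₁ q.2) ^ 2 + c₂ q.2

/-- The `α`-function of each type, at points where `denom` does not vanish. -/
noncomputable def alpha (τ : SurfaceType) (c₁ c₂ : ℝ → ℝ) (q : ℝ × ℝ) : ℝ :=
  match τ with
  | specialI => 1 / (q.1 + c₁ q.2)
  | specialII => 1 / (2 * q.1 + c₁ q.2)
  | general => (q.1 + c₁ q.2) / ((q.1 + c₁ q.2) ^ 2 + c₂ q.2)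

/-- The normal form of `b` for each type. For the general type this is
`|α| / (|x + c₁| √(1 + α²))`, with the quotient `|α| / |x + c₁|` written as `1 / |(x + c₁)² + c₂|`
so that it also has its value where `x + c₁ = 0`. -/
noncomputable def normalB (τ : SurfaceType) (c₁ c₂ : ℝ → ℝ) (q : ℝ × ℝ) : ℝ :=
  match τ with
  | specialI => τ.alpha c₁ c₂ q ^ 2 / √(1 + τ.alpha c₁ c₂ q ^ 2)
  | specialII => |τ.alpha c₁ c₂ q| / √(1 + τ.alpha c₁ c₂ q ^ 2)
  | general => 1 / (|(q.1 + c₁ q.2) ^ 2 + c₂ q.2| * √(1 + τ.alpha c₁ c₂ q ^ 2))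

end SurfaceType

/-- `X` embeds `U` as a `p`-minimal surface of type `τ` for which `(x, y)` is a normal coordinate
system, with `ζ₁` as `ζ₁`-invariant and, for the general type, `ζ₂` as `ζ₂`-invariant: the
coordinates are compatible (`e₁ = ∂/∂x`), the `α`-function has the form prescribed by the type, and
`a = 0` and `b` is in normal form. -/
structure IsNormalSurface (τ : SurfaceType) (ζ₁ ζ₂ : ℝ → ℝ) (U : Set (ℝ × ℝ))
    (X : ℝ × ℝ → H1) : Prop where
  embedding : IsSmoothEmbeddingOn X U
  minimal : IsPMinimal X U
  compatible : IsCharacteristicField X U partialX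
  denom_ne_zero : ∀ q ∈ U, τ.denom ζ₁ ζ₂ q ≠ 0
  alpha : IsAlphaFunction X U partialX (τ.alpha ζ₁ ζ₂)
  normal : IsMetricRepresentation X U partialX (τ.alpha ζ₁ ζ₂) 0 (τ.normalB ζ₁ ζ₂)

/-- The open interval `(c, d)` of real numbers, whose end points may be infinite. -/
def interval (c d : EReal) : Set ℝ := {y : ℝ | c < (y : EReal) ∧ (y : EReal) < d}

end Heisenberg

/-! Write `∂X/∂x = u e̊₁ + v e̊₂` with `u² + v² = 1`. The normal form of `b` then forces `∂X/∂y = P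
(u e̊₂ - v e̊₁) + R T`, where `P = α R` and `R = 1 / (b √(1 + α²))` depend only on the type and the
invariants. Minimality says `u_x = v_x = 0`, and the symmetry of second derivatives gives `u_y =
-P_x v`, `v_y = P_x u`: the angle of the ruling turns at the prescribed rate `P_x`.

Uniqueness (`exists_isRigidMotion_of_adaptedDerivatives`): two surfaces with the same `P`, `R` have
ruling directions differing by a constant rotation. After this rotation the parametrizations have
equal components of their derivatives in the left invariant frame, so they differ by a left
translation.

Existence: where the denominators are positive, types I and general have `P = x + ζ₁`, `R = (x +
ζ₁)² + ζ₂` (with zero in place of `ζ₂` for type I), so the angle can be taken to be `y`; type II has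
`P = 1`, `R = 2x + ζ₁`, so the angle can be taken to be `0`. Integrating in `y` gives explicit ruled
surfaces (`exists_helicoid`, `exists_parallel_ruled`), and `isNormalSurface_of_fderiv` shows that
the derivatives suffice. The remaining difficulty is injectivity when `y` ranges over more than a
full turn. The domain is therefore a steep slanted strip far out in `x`, whose planar image spirals
outwards without meeting itself (`injOn_polar`). -/

namespace Heisenberg

/-! ### Rotations and left translations -/

/-- The composition of a rotation about the `z`-axis, with cosine `k` and sine `l`, and of the left
translation by `(a, b, c)`. -/
def rotateTranslate (k l a b c : ℝ) (h : k ^ 2 + l ^ 2 = 1) : H1 ≃ H1 where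
  toFun p := (a + (k * p.1 - l * p.2.1), b + (l * p.1 + k * p.2.1),
    c + p.2.2 + b * (k * p.1 - l * p.2.1) - a * (l * p.1 + k * p.2.1))
  invFun p := (k * (p.1 - a) + l * (p.2.1 - b), -l * (p.1 - a) + k * (p.2.1 - b),
    p.2.2 - c - b * (p.1 - a) + a * (p.2.1 - b))
  left_inv p := by
    obtain ⟨x, y, z⟩ := p
    simp only [Prod.mk.injEq]
    refine ⟨?_, ?_, ?_⟩
    · linear_combination x * h
    · linear_combination y * h
    · ring
  right_inv p := by
    obtain ⟨x, y, z⟩ := p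
    simp only [Prod.mk.injEq]
    refine ⟨?_, ?_, ?_⟩
    · linear_combination (x - a) * h
    · linear_combination (y - b) * h
    · linear_combination (b * (x - a) - a * (y - b)) * h

theorem fderiv_rotateTranslate (k l a b c : ℝ) (h : k ^ 2 + l ^ 2 = 1) (p v : H1) :
    fderiv ℝ (rotateTranslate k l a b c h) p v = (k * v.1 - l * v.2.1, l * v.1 + k * v.2.1,
      v.2.2 + b * (k * v.1 - l * v.2.1) - a * (l * v.1 + k * v.2.1)) := by
  have h1 : HasFDerivAt (fun p : H1 => p.1) (ContinuousLinearMap.fst ℝ ℝ (ℝ × ℝ)) p :=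
    hasFDerivAt_fst
  have h2 : HasFDerivAt (fun p : H1 => p.2.1) _ p :=
    (hasFDerivAt_snd (𝕜 := ℝ) (E := ℝ) (F := ℝ × ℝ)).fst
  have h3 : HasFDerivAt (fun p : H1 => p.2.2) _ p :=
    (hasFDerivAt_snd (𝕜 := ℝ) (E := ℝ) (F := ℝ × ℝ)).snd
  have e1 := (h1.const_mul k).sub (h2.const_mul l)
  have e2 := (h1.const_mul l).add (h2.const_mul k)
  have e := (e1.const_add a).prodMk ((e2.const_add b).prodMk
    (((h3.const_add c).add (e1.const_mul b)).sub (e2.const_mul a)))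
  have e' : HasFDerivAt (rotateTranslate k l a b c h) _ p := e
  rw [e'.fderiv]
  simp
  ring

theorem isRigidMotion_rotateTranslate (k l a b c : ℝ) (h : k ^ 2 + l ^ 2 = 1) :
    IsRigidMotion (rotateTranslate k l a b c h) where
  smooth := by
    simp only [rotateTranslate, Equiv.coe_fn_mk]
    fun_prop
  smooth_symm := by
    simp only [rotateTranslate, Equiv.coe_fn_symm_mk]
    fun_prop
  map_contactForm p v := by
    rw [fderiv_rotateTranslate]
    simp only [contactForm, rotateTranslate, LinearMap.coe_mk, AddHom.coe_mk, Equiv.coe_fn_mk]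
    linear_combination (p.1 * v.2.1 - p.2.1 * v.1) * h
  map_J p v _ := by
    rw [fderiv_rotateTranslate, fderiv_rotateTranslate]
    simp only [J, frame1, frame2, rotateTranslate, Equiv.coe_fn_mk, Prod.smul_mk, smul_eq_mul,
      Prod.mk_sub_mk, Prod.mk.injEq]
    refine ⟨by ring, by ring, ?_⟩
    linear_combination (v.1 * p.1 + v.2.1 * p.2.1) * h

/-! ### Structure equations and uniqueness -/

/-- The coordinates of a horizontal unit vector field along `X`, together with the derivatives of
`X` in terms of it. -/
structure AdaptedDerivatives (U : Set (ℝ × ℝ)) (X : ℝ × ℝ → H1) (P R : ℝ × ℝ → ℝ)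
    (u v : ℝ × ℝ → ℝ) : Prop where
  smooth : ContDiffOn ℝ ∞ X U
  unit : ∀ q ∈ U, u q ^ 2 + v q ^ 2 = 1
  deriv_x : ∀ q ∈ U, fderiv ℝ X q (1, 0) = u q • frame1 (X q) + v q • frame2 (X q)
  deriv_y : ∀ q ∈ U, fderiv ℝ X q (0, 1) =
    P q • (u q • frame2 (X q) - v q • frame1 (X q)) + R q • frameT (X q)

/-- Dividing the normal form by `b` isolates `∂X/∂y`. The resulting coefficients do not involve `X`,
so surfaces with equal invariants share them. -/
theorem IsNormalSurface.adaptedDerivatives {τ : SurfaceType} {ζ₁ ζ₂ : ℝ → ℝ} {U : Set (ℝ × ℝ)}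
    {X : ℝ × ℝ → H1} (h : IsNormalSurface τ ζ₁ ζ₂ U X) :
    AdaptedDerivatives U X
      (fun q => τ.alpha ζ₁ ζ₂ q / (τ.normalB ζ₁ ζ₂ q * √(1 + τ.alpha ζ₁ ζ₂ q ^ 2)))
      (fun q => 1 / (τ.normalB ζ₁ ζ₂ q * √(1 + τ.alpha ζ₁ ζ₂ q ^ 2)))
      (fun q => (fderiv ℝ X q (1, 0)).1) (fun q => (fderiv ℝ X q (1, 0)).2.1) := by
  have hor : ∀ q ∈ U, (fderiv ℝ X q (1, 0)).2.2 =
      (X q).2.1 * (fderiv ℝ X q (1, 0)).1 - (X q).1 * (fderiv ℝ X q (1, 0)).2.1 := by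
    intro q hq
    have := h.compatible.horizontal q hq
    simp only [contactPlane, push, partialX, contactForm, LinearMap.mem_ker, LinearMap.coe_mk,
      AddHom.coe_mk] at this
    linarith
  refine ⟨h.embedding.smooth, fun q hq => ?_, fun q hq => ?_, fun q hq => ?_⟩
  · have := h.compatible.unit q hq
    simp only [metric, push, partialX, contactForm, LinearMap.coe_mk, AddHom.coe_mk] at this
    rw [hor q hq] at this
    linarith
  · refine Prod.ext ?_ (Prod.ext ?_ ?_) <;> simp [frame1, frame2, hor q hq]
    ring
  · have hn := h.normal q hq
    set α := τ.alpha ζ₁ ζ₂ q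
    set b := τ.normalB ζ₁ ζ₂ q
    have hs : √(1 + α ^ 2) ≠ 0 := by positivity
    have hv : ((0 : ℝ × ℝ → ℝ) q, b) = b • ((0, 1) : ℝ × ℝ) := by simp
    rw [hv, map_smul] at hn
    -- The left side of the normal form has `Θ`-component `1 / √(1 + α²)`, which is nonzero.
    have hb : b ≠ 0 := by
      intro hb
      have := congrArg (contactForm (X q)) hn
      simp [hb, contactForm, horizontalNormal, J, frame1, frame2, frameT] at this
      apply inv_ne_zero hs
      rw [← this]
      ring
    have : fderiv ℝ X q (0, 1) = b⁻¹ • (1 / √(1 + α ^ 2)) •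
        (α • horizontalNormal X partialX q + frameT (X q)) := by
      rw [hn, inv_smul_smul₀ hb]
    rw [this]
    simp only [horizontalNormal, push, J, partialX, smul_add, smul_smul]
    congr 2 <;> field_simp

/-- This is `∂_y ∂_x X = ∂_x ∂_y X` read in the first two coordinates, where the frame has constant
components. -/
theorem AdaptedDerivatives.fderiv_frame {U : Set (ℝ × ℝ)} {X : ℝ × ℝ → H1}
    {P R u v : ℝ × ℝ → ℝ} (hU : IsOpen U) (h : AdaptedDerivatives U X P R u v)
    (hu : ∀ q ∈ U, fderiv ℝ u q (1, 0) = 0) (hv : ∀ q ∈ U, fderiv ℝ v q (1, 0) = 0)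
    {q : ℝ × ℝ} (hq : q ∈ U) :
    DifferentiableAt ℝ u q ∧ DifferentiableAt ℝ v q ∧
      fderiv ℝ u q (0, 1) = -(fderiv ℝ P q (1, 0) * v q) ∧
      fderiv ℝ v q (0, 1) = fderiv ℝ P q (1, 0) * u q := by
  have hUq : U ∈ nhds q := hU.mem_nhds hq
  have hX : ContDiffAt ℝ ∞ X q := h.smooth.contDiffAt hUq
  have hd : DifferentiableAt ℝ (fderiv ℝ X) q :=
    (hX.fderiv_right (m := 1) (by norm_cast)).differentiableAt (by norm_num)
  have hsym := hX.isSymmSndFDerivAt (by simp; norm_cast) (1, 0) (0, 1)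
  set D := fderiv ℝ (fderiv ℝ X) q
  have hdir (w : ℝ × ℝ) : HasFDerivAt (fun s => fderiv ℝ X s w) (D.flip w) q := by
    refine (hd.hasFDerivAt.clm_apply (hasFDerivAt_const w q)).congr_fderiv ?_
    ext <;> simp [D]
  have hu' : HasFDerivAt u _ q := (hdir (1, 0)).fst.congr_of_eventuallyEq (by
    filter_upwards [hUq] with s hs
    rw [h.deriv_x s hs]; simp [frame1, frame2])
  have hv' : HasFDerivAt v _ q := (hdir (1, 0)).snd.fst.congr_of_eventuallyEq (by
    filter_upwards [hUq] with s hs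
    rw [h.deriv_x s hs]; simp [frame1, frame2])
  have h1 : (fun s => (fderiv ℝ X s (0, 1)).1) =ᶠ[nhds q] fun s => -(P s * v s) := by
    filter_upwards [hUq] with s hs
    rw [h.deriv_y s hs]; simp [frame1, frame2, frameT]
  have h2 : (fun s => (fderiv ℝ X s (0, 1)).2.1) =ᶠ[nhds q] fun s => P s * u s := by
    filter_upwards [hUq] with s hs
    rw [h.deriv_y s hs]; simp [frame1, frame2, frameT]
  -- No regularity of `P` is assumed; it is recovered as the inner product of the planar part of
  -- `∂X/∂y` with the unit vector `(-v, u)`.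
  have hP : DifferentiableAt ℝ P q := by
    have e := ((hdir (0, 1)).snd.fst.differentiableAt.mul hu'.differentiableAt).sub
      ((hdir (0, 1)).fst.differentiableAt.mul hv'.differentiableAt)
    refine e.congr_of_eventuallyEq ?_
    filter_upwards [hUq, h1, h2] with s hs h1 h2
    simp only [Pi.sub_apply, Pi.mul_apply]
    rw [h1, h2]
    linear_combination -P s * h.unit s hs
  have e1 := ((hdir (0, 1)).fst.congr_of_eventuallyEq h1.symm).unique
    (hP.hasFDerivAt.mul hv'.differentiableAt.hasFDerivAt).neg
  have e2 := ((hdir (0, 1)).snd.fst.congr_of_eventuallyEq h2.symm).unique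
    (hP.hasFDerivAt.mul hu'.differentiableAt.hasFDerivAt)
  have e1 := DFunLike.congr_fun e1 (1, 0)
  have e2 := DFunLike.congr_fun e2 (1, 0)
  refine ⟨hu'.differentiableAt, hv'.differentiableAt, ?_, ?_⟩
  · rw [hu'.fderiv]
    simp [hv q hq] at e1
    simp [← hsym, e1]
    ring
  · rw [hv'.fderiv]
    simp [hu q hq] at e2
    simp [← hsym, e2]
    ring

theorem fderiv_eq_zero_of_partials {f : ℝ × ℝ → ℝ} {q : ℝ × ℝ}
    (hx : fderiv ℝ f q (1, 0) = 0) (hy : fderiv ℝ f q (0, 1) = 0) : fderiv ℝ f q = 0 := by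
  ext <;> simp [hx, hy]

theorem IsNormalSurface.fderiv_frame_x {τ : SurfaceType} {ζ₁ ζ₂ : ℝ → ℝ} {U : Set (ℝ × ℝ)}
    {X : ℝ × ℝ → H1} (hU : IsOpen U) (h : IsNormalSurface τ ζ₁ ζ₂ U X) {q : ℝ × ℝ} (hq : q ∈ U) :
    fderiv ℝ (fun s => (fderiv ℝ X s (1, 0)).1) q (1, 0) = 0 ∧
      fderiv ℝ (fun s => (fderiv ℝ X s (1, 0)).2.1) q (1, 0) = 0 := by
  have hm := h.minimal U subset_rfl hU partialX h.compatible q hq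
  have h1 := congrArg Prod.fst hm
  have h2 := congrArg (fun p : H1 => p.2.1) hm
  simp [covDeriv, horizontalNormal, J, push, partialX, frame1, frame2, frameT] at h1 h2
  exact ⟨h2, h1⟩

theorem exists_isRigidMotion_of_adaptedDerivatives {U : Set (ℝ × ℝ)} {X Y : ℝ × ℝ → H1}
    {P R u v u' v' : ℝ × ℝ → ℝ} (hU : IsOpen U) (hc : IsConnected U)
    (hX : AdaptedDerivatives U X P R u v) (hY : AdaptedDerivatives U Y P R u' v')
    (hu : ∀ q ∈ U, fderiv ℝ u q (1, 0) = 0) (hv : ∀ q ∈ U, fderiv ℝ v q (1, 0) = 0)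
    (hu' : ∀ q ∈ U, fderiv ℝ u' q (1, 0) = 0) (hv' : ∀ q ∈ U, fderiv ℝ v' q (1, 0) = 0) :
    ∃ Φ : H1 ≃ H1, IsRigidMotion Φ ∧ ∀ q ∈ U, Y q = Φ (X q) := by
  have const (f : ℝ × ℝ → ℝ)
      (hf : ∀ q ∈ U, ∃ L : ℝ × ℝ →L[ℝ] ℝ, HasFDerivAt f L q ∧ L (1, 0) = 0 ∧ L (0, 1) = 0) :
      ∃ c, ∀ q ∈ U, f q = c := by
    refine hU.exists_is_const_of_fderiv_eq_zero hc.isPreconnected (𝕜 := ℝ) (fun q hq => ?_)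
      fun q hq => ?_
    · obtain ⟨L, hL, -⟩ := hf q hq
      exact hL.differentiableAt.differentiableWithinAt
    · obtain ⟨L, hL, h1, h2⟩ := hf q hq
      apply fderiv_eq_zero_of_partials <;> rwa [hL.fderiv]
  -- `k` and `l` are the cosine and sine of the angle from `(u, v)` to `(u', v')`; both angles turn
  -- at the rate `P_x`.
  obtain ⟨k, hk⟩ := const (fun q => u q * u' q + v q * v' q) fun q hq => by
    obtain ⟨du, dv, uy, vy⟩ := hX.fderiv_frame hU hu hv hq
    obtain ⟨du', dv', uy', vy'⟩ := hY.fderiv_frame hU hu' hv' hq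
    refine ⟨_, (du.hasFDerivAt.mul du'.hasFDerivAt).add (dv.hasFDerivAt.mul dv'.hasFDerivAt), ?_, ?_⟩
    · simp [hu q hq, hv q hq, hu' q hq, hv' q hq]
    · simp [uy, vy, uy', vy']
      ring
  obtain ⟨l, hl⟩ := const (fun q => u q * v' q - v q * u' q) fun q hq => by
    obtain ⟨du, dv, uy, vy⟩ := hX.fderiv_frame hU hu hv hq
    obtain ⟨du', dv', uy', vy'⟩ := hY.fderiv_frame hU hu' hv' hq
    refine ⟨_, (du.hasFDerivAt.mul dv'.hasFDerivAt).sub (dv.hasFDerivAt.mul du'.hasFDerivAt), ?_, ?_⟩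
    · simp [hu q hq, hv q hq, hu' q hq, hv' q hq]
    · simp [uy, vy, uy', vy']
      ring
  have hkl : k ^ 2 + l ^ 2 = 1 := by
    obtain ⟨q, hq⟩ := hc.nonempty
    rw [← hk q hq, ← hl q hq]
    linear_combination (u' q ^ 2 + v' q ^ 2) * hX.unit q hq + hY.unit q hq
  have eu (q) (hq : q ∈ U) : u' q = k * u q - l * v q := by
    rw [← hk q hq, ← hl q hq]
    linear_combination -u' q * hX.unit q hq
  have ev (q) (hq : q ∈ U) : v' q = l * u q + k * v q := by
    rw [← hk q hq, ← hl q hq]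
    linear_combination -v' q * hX.unit q hq
  have dX (q) (hq : q ∈ U) : HasFDerivAt X (fderiv ℝ X q) q :=
    ((hX.smooth.contDiffAt (hU.mem_nhds hq)).differentiableAt (by simp)).hasFDerivAt
  have dY (q) (hq : q ∈ U) : HasFDerivAt Y (fderiv ℝ Y q) q :=
    ((hY.smooth.contDiffAt (hU.mem_nhds hq)).differentiableAt (by simp)).hasFDerivAt
  obtain ⟨a, ha⟩ := const (fun q => (Y q).1 - (k * (X q).1 - l * (X q).2.1)) fun q hq => by
    refine ⟨_, (dY q hq).fst.sub (((dX q hq).fst.const_mul k).sub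
      ((dX q hq).snd.fst.const_mul l)), ?_, ?_⟩
    · simp [hX.deriv_x q hq, hY.deriv_x q hq, frame1, frame2, eu q hq]
    · simp [hX.deriv_y q hq, hY.deriv_y q hq, frame1, frame2, frameT, ev q hq]
      ring
  obtain ⟨b, hb⟩ := const (fun q => (Y q).2.1 - (l * (X q).1 + k * (X q).2.1)) fun q hq => by
    refine ⟨_, (dY q hq).snd.fst.sub (((dX q hq).fst.const_mul l).add
      ((dX q hq).snd.fst.const_mul k)), ?_, ?_⟩
    · simp [hX.deriv_x q hq, hY.deriv_x q hq, frame1, frame2, ev q hq]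
    · simp [hX.deriv_y q hq, hY.deriv_y q hq, frame1, frame2, frameT, eu q hq]
      ring
  have ea (q) (hq : q ∈ U) : (Y q).1 = a + (k * (X q).1 - l * (X q).2.1) := by
    linarith [ha q hq]
  have eb (q) (hq : q ∈ U) : (Y q).2.1 = b + (l * (X q).1 + k * (X q).2.1) := by
    linarith [hb q hq]
  -- The vertical components of the frame depend on the base point, so this step needs the planar
  -- relations `ea` and `eb`.
  obtain ⟨c, hc⟩ := const (fun q => (Y q).2.2 - ((X q).2.2 + b * (k * (X q).1 - l * (X q).2.1)
      - a * (l * (X q).1 + k * (X q).2.1))) fun q hq => by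
    have e1 := ((dX q hq).fst.const_mul k).sub ((dX q hq).snd.fst.const_mul l)
    have e2 := ((dX q hq).fst.const_mul l).add ((dX q hq).snd.fst.const_mul k)
    refine ⟨_, (dY q hq).snd.snd.sub (((dX q hq).snd.snd.add (e1.const_mul b)).sub
      (e2.const_mul a)), ?_, ?_⟩
    · simp [hX.deriv_x q hq, hY.deriv_x q hq, frame1, frame2, eu q hq, ev q hq, ea q hq, eb q hq]
      linear_combination (u q * (X q).2.1 - v q * (X q).1) * hkl
    · simp [hX.deriv_y q hq, hY.deriv_y q hq, frame1, frame2, frameT, eu q hq, ev q hq, ea q hq,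
        eb q hq]
      linear_combination (- P q * u q * (X q).1 - P q * v q * (X q).2.1) * hkl
  refine ⟨_, isRigidMotion_rotateTranslate k l a b c hkl, fun q hq => ?_⟩
  refine Prod.ext (ea q hq) (Prod.ext (eb q hq) ?_)
  change (Y q).2.2 = c + (X q).2.2 + b * (k * (X q).1 - l * (X q).2.1)
    - a * (l * (X q).1 + k * (X q).2.1)
  linarith [hc q hq]

theorem IsNormalSurface.exists_isRigidMotion {τ : SurfaceType} {ζ₁ ζ₂ : ℝ → ℝ} {U : Set (ℝ × ℝ)}
    {X Y : ℝ × ℝ → H1} (hU : IsOpen U) (hc : IsConnected U) (hX : IsNormalSurface τ ζ₁ ζ₂ U X)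
    (hY : IsNormalSurface τ ζ₁ ζ₂ U Y) :
    ∃ Φ : H1 ≃ H1, IsRigidMotion Φ ∧ ∀ q ∈ U, Y q = Φ (X q) :=
  exists_isRigidMotion_of_adaptedDerivatives hU hc hX.adaptedDerivatives hY.adaptedDerivatives
    (fun _ hq => (hX.fderiv_frame_x hU hq).1) (fun _ hq => (hX.fderiv_frame_x hU hq).2)
    (fun _ hq => (hY.fderiv_frame_x hU hq).1) (fun _ hq => (hY.fderiv_frame_x hU hq).2)

/-! ### Recognizing a normal surface from its derivatives -/

theorem fderiv_apply_eq_smul_add_smul (X : ℝ × ℝ → H1) (q w : ℝ × ℝ) :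
    fderiv ℝ X q w = w.1 • fderiv ℝ X q (1, 0) + w.2 • fderiv ℝ X q (0, 1) := by
  rw [← map_smul, ← map_smul, ← map_add]
  simp

/-- A surface whose rulings have an angle `κ * y` depending linearly on `y`, and whose derivative is
prescribed by the type, is a normal surface. -/
theorem isNormalSurface_of_fderiv {τ : SurfaceType} {ζ₁ ζ₂ : ℝ → ℝ} {U : Set (ℝ × ℝ)}
    {X : ℝ × ℝ → H1} {P R : ℝ × ℝ → ℝ} (κ : ℝ) (hsm : ContDiffOn ℝ ∞ X U)
    (hemb : Topology.IsEmbedding (U.domRestrict X))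
    (hx : ∀ q ∈ U, fderiv ℝ X q (1, 0) =
      Real.cos (κ * q.2) • frame1 (X q) + Real.sin (κ * q.2) • frame2 (X q))
    (hy : ∀ q ∈ U, fderiv ℝ X q (0, 1) = P q • (Real.cos (κ * q.2) • frame2 (X q)
      - Real.sin (κ * q.2) • frame1 (X q)) + R q • frameT (X q))
    (hR : ∀ q ∈ U, R q ≠ 0) (hden : ∀ q ∈ U, τ.denom ζ₁ ζ₂ q ≠ 0)
    (hα : ∀ q ∈ U, τ.alpha ζ₁ ζ₂ q = P q / R q)
    (hb : ∀ q ∈ U, τ.normalB ζ₁ ζ₂ q = 1 / (R q * √(1 + τ.alpha ζ₁ ζ₂ q ^ 2))) :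
    IsNormalSurface τ ζ₁ ζ₂ U X := by
  have hxT (q) (hq : q ∈ U) : contactForm (X q) (fderiv ℝ X q (1, 0)) = 0 := by
    simp [hx q hq, contactForm, frame1, frame2]
    ring
  have hyT (q) (hq : q ∈ U) : contactForm (X q) (fderiv ℝ X q (0, 1)) = R q := by
    simp [hy q hq, contactForm, frame1, frame2, frameT]
    ring
  have hT (q) (hq : q ∈ U) (w : ℝ × ℝ) : contactForm (X q) (fderiv ℝ X q w) = w.2 * R q := by
    rw [fderiv_apply_eq_smul_add_smul, map_add, map_smul, map_smul, hxT q hq, hyT q hq]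
    simp
  have hreg (q) (hq : q ∈ U) : IsRegularPoint X q := by
    intro he
    have : fderiv ℝ X q (0, 1) ∈ tangentPlane X q := ⟨(0, 1), rfl⟩
    rw [he, contactPlane, LinearMap.mem_ker, hyT q hq] at this
    exact hR q hq this
  have hnor (q) (hq : q ∈ U) : τ.alpha ζ₁ ζ₂ q • horizontalNormal X partialX q + frameT (X q) =
      (1 / R q) • fderiv ℝ X q (0, 1) := by
    have := hR q hq
    rw [hα q hq, hy q hq, horizontalNormal, push, partialX, hx q hq]
    refine Prod.ext ?_ (Prod.ext ?_ ?_) <;> simp [J, frame1, frame2, frameT] <;> field_simp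
  refine ⟨⟨hsm, fun q hq => ?_, hemb⟩, ?_, ⟨hreg, contDiffOn_const, fun q hq => hxT q hq,
    fun q hq => ?_⟩, hden, fun q hq => ?_, fun q hq => ?_⟩
  · refine (injective_iff_map_eq_zero _).2 fun w hw => ?_
    have h2 : w.2 = 0 := by
      have := hT q hq w
      rw [hw, map_zero] at this
      simpa [hR q hq] using this.symm
    rw [fderiv_apply_eq_smul_add_smul, h2, hx q hq] at hw
    have e1 := congrArg Prod.fst hw
    have e2 := congrArg (fun p : H1 => p.2.1) hw
    simp [frame1, frame2] at e1 e2
    refine Prod.ext ?_ h2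
    rcases e1 with e1 | e1
    · exact e1
    · rcases e2 with e2 | e2
      · exact e2
      · have := Real.sin_sq_add_cos_sq (κ * q.2)
        simp [e1, e2] at this
  -- Since `Θ(X_* w) = w.2 * R`, a characteristic field is `±∂/∂x`. Its horizontal normal has frame
  -- components `±(-sin, cos)` of `κ * y`, constant along the ruling.
  · intro V hVU hV E hE q hq
    have hE2 (s) (hs : s ∈ V) : (E s).2 = 0 := by
      have := hE.horizontal s hs
      rw [contactPlane, LinearMap.mem_ker, push, hT s (hVU hs)] at this
      simpa [hR s (hVU hs)] using this
    have hp (s) (hs : s ∈ V) : push X E s = (E s).1 • (Real.cos (κ * s.2) • frame1 (X s) +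
        Real.sin (κ * s.2) • frame2 (X s)) := by
      rw [push, fderiv_apply_eq_smul_add_smul, hE2 s hs, hx s (hVU hs)]
      simp
    have hE1 (s) (hs : s ∈ V) : (E s).1 * (E s).1 = 1 := by
      have := hE.unit s hs
      have hc := hE.horizontal s hs
      rw [contactPlane, LinearMap.mem_ker] at hc
      rw [metric, hc, hp s hs] at this
      simp [frame1, frame2] at this
      linear_combination this - (E s).1 * (E s).1 * Real.sin_sq_add_cos_sq (κ * s.2)
    have hVq := hV.mem_nhds hq
    have dE : HasFDerivAt (fun s => (E s).1) _ q :=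
      (((hE.smooth.contDiffAt hVq).differentiableAt (by simp)).hasFDerivAt).fst
    -- Differentiating `(E s).1 ^ 2 = 1` shows that the sign is locally constant, without any
    -- connectedness of `V`.
    have hz := (dE.mul dE).unique ((hasFDerivAt_const (1 : ℝ) q).congr_of_eventuallyEq (by
      filter_upwards [hVq] with s hs using hE1 s hs))
    have hne : (E q).1 ≠ 0 := fun h => by simpa [h] using hE1 q hq
    have hz : (ContinuousLinearMap.fst ℝ ℝ ℝ ∘L fderiv ℝ E q) (E q) = 0 := by
      have := DFunLike.congr_fun hz (E q)
      simp at this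
      simpa [hne, ← two_mul] using this
    have dθ : HasFDerivAt (fun s : ℝ × ℝ => κ * s.2) (κ • ContinuousLinearMap.snd ℝ ℝ ℝ) q :=
      (hasFDerivAt_snd (𝕜 := ℝ) (E := ℝ) (F := ℝ)).const_mul κ
    have d1 : fderiv ℝ (fun s => (horizontalNormal X E s).1) q (E q) = 0 := by
      have e : HasFDerivAt (fun s => (horizontalNormal X E s).1) _ q :=
        (dE.mul dθ.sin).neg.congr_of_eventuallyEq (by
          filter_upwards [hVq] with s hs
          simp [horizontalNormal, J, hp s hs, frame1, frame2])
      rw [e.fderiv]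
      simp at hz
      simp [hz, hE2 q hq]
    have d2 : fderiv ℝ (fun s => (horizontalNormal X E s).2.1) q (E q) = 0 := by
      have e : HasFDerivAt (fun s => (horizontalNormal X E s).2.1) _ q :=
        (dE.mul dθ.cos).congr_of_eventuallyEq (by
          filter_upwards [hVq] with s hs
          simp [horizontalNormal, J, hp s hs, frame1, frame2])
      rw [e.fderiv]
      simp at hz
      simp [hz, hE2 q hq]
    have d3 : (fun s => contactForm (X s) (horizontalNormal X E s)) = fun _ => 0 := by
      funext s
      simp [horizontalNormal, contactForm, J, frame1, frame2]
      ring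
    rw [covDeriv, d1, d2, d3]
    simp
  · have := hxT q hq
    simp only [metric, push, partialX]
    rw [this, hx q hq]
    simp [frame1, frame2]
    linear_combination Real.sin_sq_add_cos_sq (κ * q.2)
  · rw [hnor q hq]
    exact Submodule.smul_mem _ _ ⟨(0, 1), rfl⟩
  · rw [hnor q hq, Pi.zero_apply, fderiv_apply_eq_smul_add_smul X q (0, τ.normalB ζ₁ ζ₂ q),
      hb q hq, smul_smul, zero_smul, zero_add]
    congr 1
    field_simp

/-! ### Intervals, antiderivatives and slanted strips -/

theorem isOpen_interval (c d : EReal) : IsOpen (interval c d) :=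
  isOpen_Ioo.preimage continuous_coe_real_ereal

theorem ordConnected_interval (c d : EReal) : (interval c d).OrdConnected :=
  Set.ordConnected_Ioo.preimage_mono fun _ _ h => EReal.coe_le_coe_iff.2 h

theorem exists_contDiffOn_antiderivative {I : Set ℝ} (hI : IsOpen I) (hc : I.OrdConnected)
    {f : ℝ → ℝ} (hf : ContDiffOn ℝ ∞ f I) :
    ∃ F : ℝ → ℝ, ContDiffOn ℝ ∞ F I ∧ ∀ y ∈ I, HasDerivAt F (f y) y := by
  obtain rfl | ⟨y₀, h₀⟩ := I.eq_empty_or_nonempty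
  · exact ⟨0, contDiffOn_const, by simp⟩
  have hF (y) (hy : y ∈ I) : HasDerivAt (fun y => ∫ t in y₀..y, f t) (f y) y :=
    intervalIntegral.integral_hasDerivAt_right
      ((hf.continuousOn.mono (hc.uIcc_subset h₀ hy)).intervalIntegrable)
      (hf.continuousOn.stronglyMeasurableAtFilter hI y hy)
      (hf.continuousOn.continuousAt (hI.mem_nhds hy))
  refine ⟨_, (contDiffOn_infty_iff_deriv_of_isOpen hI).2
    ⟨fun y hy => (hF y hy).differentiableAt.differentiableWithinAt, ?_⟩, hF⟩
  exact hf.congr fun y hy => (hF y hy).deriv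

/-- The margin lets an open strip project onto a set containing the given compact interval, while
the data stay bounded on the larger compact one. -/
theorem exists_Icc_subset_of_isOpen {I : Set ℝ} (hI : IsOpen I) (hc : I.OrdConnected) {a b : ℝ}
    (hab : a ≤ b) (h : Set.Icc a b ⊆ I) : ∃ a' < a, ∃ b' > b, Set.Icc a' b' ⊆ I := by
  obtain ⟨a', ha', h1⟩ := Metric.isOpen_iff.1 hI a (h ⟨le_rfl, hab⟩)
  obtain ⟨b', hb', h2⟩ := Metric.isOpen_iff.1 hI b (h ⟨hab, le_rfl⟩)
  refine ⟨a - a' / 2, by linarith, b + b' / 2, by linarith, hc.out (h1 ?_) (h2 ?_)⟩ <;>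
    rw [Metric.mem_ball, Real.dist_eq, abs_lt] <;> constructor <;> linarith

/-- The part over `(a, b)` of a strip of width one in the plane, with slope `L`. -/
def strip (a b N L : ℝ) : Set (ℝ × ℝ) :=
  {q | q.2 ∈ Set.Ioo a b ∧ q.1 - L * (q.2 - a) ∈ Set.Ioo N (N + 1)}

theorem isOpen_strip (a b N L : ℝ) : IsOpen (strip a b N L) :=
  (isOpen_Ioo.preimage continuous_snd).inter
    (isOpen_Ioo.preimage (f := fun q : ℝ × ℝ => q.1 - L * (q.2 - a)) (by fun_prop))

theorem strip_eq_image (a b N L : ℝ) : strip a b N L =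
    (fun q : ℝ × ℝ => (q.1 + L * (q.2 - a), q.2)) '' Set.Ioo N (N + 1) ×ˢ Set.Ioo a b := by
  ext ⟨x, y⟩
  constructor
  · rintro ⟨hy, hx⟩
    exact ⟨(x - L * (y - a), y), ⟨hx, hy⟩, by simp⟩
  · rintro ⟨⟨t, s⟩, ⟨ht, hs⟩, he⟩
    simp only [Prod.mk.injEq] at he
    obtain ⟨rfl, rfl⟩ := he
    exact ⟨hs, by simpa using ht⟩

theorem isConnected_strip {a b : ℝ} (hab : a < b) (N L : ℝ) : IsConnected (strip a b N L) := by
  rw [strip_eq_image]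
  exact ((isConnected_Ioo (by linarith)).prod (isConnected_Ioo hab)).image _
    (by fun_prop)

theorem snd_image_strip (a b N L : ℝ) : Prod.snd '' strip a b N L = Set.Ioo a b := by
  ext y
  constructor
  · rintro ⟨q, hq, rfl⟩
    exact hq.1
  · intro hy
    refine ⟨(N + 1 / 2 + L * (y - a), y), ⟨hy, ?_⟩, rfl⟩
    constructor <;> norm_num

theorem fst_lt_of_mem_strip {a b N L : ℝ} (hL : 0 ≤ L) {q : ℝ × ℝ} (hq : q ∈ strip a b N L) :
    N < q.1 ∧ q.1 < N + 1 + L * (b - a) := by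
  obtain ⟨⟨h1, h2⟩, h3, h4⟩ := hq
  constructor
  · nlinarith
  · nlinarith

/-! ### Embeddedness through the planar projection -/

/-- The projection to the first two coordinates is injective with invertible derivative, hence an
open embedding; a continuous map through which an embedding factors as first factor is itself an
embedding. -/
theorem isEmbedding_domRestrict_of_planar {U : Set (ℝ × ℝ)} {X : ℝ × ℝ → H1} (hU : IsOpen U)
    (hsm : ContDiffOn ℝ ∞ X U) (hinj : Set.InjOn (fun q => ((X q).1, (X q).2.1)) U)
    (hdet : ∀ q ∈ U, (fderiv ℝ X q (1, 0)).1 * (fderiv ℝ X q (0, 1)).2.1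
      - (fderiv ℝ X q (1, 0)).2.1 * (fderiv ℝ X q (0, 1)).1 ≠ 0) :
    Topology.IsEmbedding (U.domRestrict X) := by
  have hcX : Continuous (U.domRestrict X) := continuousOn_iff_continuous_domRestrict.1 hsm.continuousOn
  have hcg : Continuous (fun p : H1 => (p.1, p.2.1)) := by fun_prop
  refine Topology.IsEmbedding.of_comp hcX hcg
    (Topology.IsOpenEmbedding.of_continuous_injective_isOpenMap (hcg.comp hcX) ?_ ?_).isEmbedding
  · exact Set.injOn_iff_injective.1 hinj
  · refine IsOpenMap.of_nhds_le fun q => ?_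
    have hX : HasStrictFDerivAt X (fderiv ℝ X q) q :=
      (hsm.contDiffAt (hU.mem_nhds q.2)).hasStrictFDerivAt (by simp)
    have hF := hX.fst.prodMk hX.snd.fst
    have hmap := hF.map_nhds_eq_of_surj (by
      rw [LinearMap.range_eq_top]
      intro w
      have hd := hdet q q.2
      set D := (fderiv ℝ X q (1, 0)).1 * (fderiv ℝ X q (0, 1)).2.1
        - (fderiv ℝ X q (1, 0)).2.1 * (fderiv ℝ X q (0, 1)).1 with hD
      -- Cramer's rule.
      refine ⟨((w.1 * (fderiv ℝ X q (0, 1)).2.1 - w.2 * (fderiv ℝ X q (0, 1)).1) / D,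
        ((fderiv ℝ X q (1, 0)).1 * w.2 - (fderiv ℝ X q (1, 0)).2.1 * w.1) / D), ?_⟩
      refine Prod.ext ?_ ?_
      · simp
        rw [fderiv_apply_eq_smul_add_smul]
        simp
        field_simp
        rw [hD]
        ring
      · simp
        rw [fderiv_apply_eq_smul_add_smul]
        simp
        field_simp
        rw [hD]
        ring)
    have hval : Filter.map (Subtype.val : U → ℝ × ℝ) (nhds q) = nhds q.1 :=
      map_nhds_subtype_coe_eq_nhds q.2 (hU.mem_nhds q.2)
    rw [← hval, Filter.map_map] at hmap
    exact hmap.ge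

/-- Two parameters whose angles differ by at least one have radii too far apart for the bounded
shifts `A`, `B` to compensate. For closer angles, the large radius makes the rotation outweigh the
Lipschitz variation of the shifts. -/
theorem injOn_polar {A B : ℝ → ℝ} {a b K : ℝ} (hK : 1 ≤ K)
    (hA : ∀ y ∈ Set.Ioo a b, |A y| ≤ K) (hB : ∀ y ∈ Set.Ioo a b, |B y| ≤ K)
    (hA' : ∀ s ∈ Set.Ioo a b, ∀ t ∈ Set.Ioo a b, |A s - A t| ≤ K * |s - t|)
    (hB' : ∀ s ∈ Set.Ioo a b, ∀ t ∈ Set.Ioo a b, |B s - B t| ≤ K * |s - t|) :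
    Set.InjOn (fun q : ℝ × ℝ =>
      (q.1 * Real.cos q.2 - A q.2, q.1 * Real.sin q.2 + B q.2)) (strip a b (10 * K) (10 * K)) := by
  have key : ∀ p ∈ strip a b (10 * K) (10 * K), ∀ q ∈ strip a b (10 * K) (10 * K), p.2 ≤ q.2 →
      p.1 * Real.cos p.2 - A p.2 = q.1 * Real.cos q.2 - A q.2 →
      p.1 * Real.sin p.2 + B p.2 = q.1 * Real.sin q.2 + B q.2 → p = q := by
    intro p hp q hq hpq h1 h2
    have hp0 := (fst_lt_of_mem_strip (by linarith) hp).1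
    have hq0 := (fst_lt_of_mem_strip (by linarith) hq).1
    obtain ⟨x, s⟩ := p
    obtain ⟨x', t⟩ := q
    obtain ⟨hs, hx1, hx2⟩ := hp
    obtain ⟨ht, hx1', hx2'⟩ := hq
    simp only at *
    rcases le_or_gt 1 (t - s) with hd | hd
    · exfalso
      have hAs := abs_le.1 (hA s hs)
      have hAt := abs_le.1 (hA t ht)
      have hBs := abs_le.1 (hB s hs)
      have hBt := abs_le.1 (hB t ht)
      -- The slope contributes at least `10 * K`, and the width of the strip costs at most `1 ≤ K`.
      -- The law of cosines `e3` then gives `(x' - x)² ≤ 8 * K²`, a contradiction.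
      have hgap : 9 * K ≤ x' - x := by nlinarith
      have e1 : (A s - A t) ^ 2 ≤ (2 * K) ^ 2 := sq_le_sq' (by linarith) (by linarith)
      have e2 : (B t - B s) ^ 2 ≤ (2 * K) ^ 2 := sq_le_sq' (by linarith) (by linarith)
      have e3 : (A s - A t) ^ 2 + (B t - B s) ^ 2
          = x ^ 2 + x' ^ 2 - 2 * (x * x') * Real.cos (t - s) := by
        rw [show A s - A t = x * Real.cos s - x' * Real.cos t by linarith,
          show B t - B s = x * Real.sin s - x' * Real.sin t by linarith, Real.cos_sub]
        linear_combination x ^ 2 * Real.sin_sq_add_cos_sq s + x' ^ 2 * Real.sin_sq_add_cos_sq t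
      have e4 : x * x' * Real.cos (t - s) ≤ x * x' :=
        mul_le_of_le_one_right (mul_nonneg (by linarith) (by linarith)) (Real.cos_le_one _)
      nlinarith
    · have hts : t = s := by
        by_contra hne
        have hlt : 0 < t - s := by
          rcases lt_or_eq_of_le hpq with h | h
          · linarith
          · exact absurd h.symm hne
        have hAd := hA' s hs t ht
        have hBd := hB' t ht s hs
        rw [abs_sub_comm s t, abs_of_pos hlt] at hAd
        rw [abs_of_pos hlt] at hBd
        -- Jordan's inequality `sin z ≥ 2z/π`, together with `π ≤ 4`.
        have hsin : (t - s) / 4 ≤ Real.sin ((t - s) / 2) := by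
          have := Real.mul_le_sin (x := (t - s) / 2) (by linarith) (by linarith [Real.pi_gt_three])
          refine le_trans ?_ this
          rw [div_mul_div_comm, div_le_div_iff₀ (by norm_num) (by positivity)]
          nlinarith [Real.pi_le_four]
        -- The difference of the two planar points, projected onto the normal of the direction with
        -- the mean angle.
        have e : (x + x') * Real.sin ((t - s) / 2) =
            Real.sin ((s + t) / 2) * (A s - A t) - Real.cos ((s + t) / 2) * (B t - B s) := by
          rw [show A s - A t = x * Real.cos s - x' * Real.cos t by linarith,
            show B t - B s = x * Real.sin s - x' * Real.sin t by linarith]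
          have r1 : Real.sin ((t - s) / 2) = Real.sin ((s + t) / 2) * Real.cos s
              - Real.cos ((s + t) / 2) * Real.sin s := by
            rw [← Real.sin_sub]; congr 1; ring
          have r2 : Real.sin ((t - s) / 2) = Real.sin t * Real.cos ((s + t) / 2)
              - Real.cos t * Real.sin ((s + t) / 2) := by
            rw [← Real.sin_sub]; congr 1; ring
          linear_combination x * r1 + x' * r2
        have b1 : |Real.sin ((s + t) / 2) * (A s - A t)| ≤ K * (t - s) := by
          rw [abs_mul]
          exact (mul_le_of_le_one_left (abs_nonneg _) (Real.abs_sin_le_one _)).trans hAd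
        have b2 : |Real.cos ((s + t) / 2) * (B t - B s)| ≤ K * (t - s) := by
          rw [abs_mul]
          exact (mul_le_of_le_one_left (abs_nonneg _) (Real.abs_cos_le_one _)).trans hBd
        have b3 : (x + x') * ((t - s) / 4) ≤ (x + x') * Real.sin ((t - s) / 2) :=
          mul_le_mul_of_nonneg_left hsin (by linarith)
        have b4 : 20 * K * ((t - s) / 4) < (x + x') * ((t - s) / 4) :=
          mul_lt_mul_of_pos_right (by linarith) (by linarith)
        have b5 : 0 < K * (t - s) := mul_pos (by linarith) hlt
        linarith [(abs_le.1 b1).2, (abs_le.1 b2).1]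
      subst hts
      have hc : (x - x') * Real.cos t = 0 := by linarith
      have hs : (x - x') * Real.sin t = 0 := by linarith
      have : x = x' := by
        linear_combination -(x - x') * Real.sin_sq_add_cos_sq t + Real.cos t * hc + Real.sin t * hs
      rw [this]
  intro p hp q hq hpq
  simp only [Prod.mk.injEq] at hpq
  rcases le_total p.2 q.2 with h | h
  · exact key p hp q hq h hpq.1 hpq.2
  · exact (key q hq p hp h hpq.1.symm hpq.2.symm).symm

theorem abs_sub_le_of_hasDerivAt {F f : ℝ → ℝ} {a b K : ℝ}
    (hF : ∀ y ∈ Set.Ioo a b, HasDerivAt F (f y) y) (hf : ∀ y ∈ Set.Ioo a b, |f y| ≤ K) :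
    ∀ s ∈ Set.Ioo a b, ∀ t ∈ Set.Ioo a b, |F s - F t| ≤ K * |s - t| := fun _ hs _ ht =>
  (convex_Ioo a b).norm_image_sub_le_of_norm_hasDerivWithin_le
    (fun y hy => (hF y hy).hasDerivWithinAt) hf ht hs

/-! ### Explicit ruled surfaces -/

/-- Derivative of the explicit parametrization of a surface ruled by lines of angle `y`. -/
theorem fderiv_helicoid {A B C : ℝ → ℝ} {ζ η : ℝ} {q : ℝ × ℝ}
    (hA : HasDerivAt A (ζ * Real.sin q.2) q.2) (hB : HasDerivAt B (ζ * Real.cos q.2) q.2)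
    (hC : HasDerivAt C (ζ ^ 2 + η - ζ * (B q.2 * Real.sin q.2 - A q.2 * Real.cos q.2)) q.2) :
    let X : ℝ × ℝ → H1 := fun q => (q.1 * Real.cos q.2 - A q.2, q.1 * Real.sin q.2 + B q.2,
      q.1 * (B q.2 * Real.cos q.2 + A q.2 * Real.sin q.2) + C q.2)
    fderiv ℝ X q (1, 0) = Real.cos q.2 • frame1 (X q) + Real.sin q.2 • frame2 (X q) ∧
    fderiv ℝ X q (0, 1) = (q.1 + ζ) • (Real.cos q.2 • frame2 (X q) - Real.sin q.2 • frame1 (X q))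
      + ((q.1 + ζ) ^ 2 + η) • frameT (X q) := by
  intro X
  have d1 : HasFDerivAt (fun q : ℝ × ℝ => q.1) (ContinuousLinearMap.fst ℝ ℝ ℝ) q := hasFDerivAt_fst
  have d2 : HasFDerivAt (fun q : ℝ × ℝ => q.2) (ContinuousLinearMap.snd ℝ ℝ ℝ) q := hasFDerivAt_snd
  have dA := hA.comp_hasFDerivAt q d2
  have dB := hB.comp_hasFDerivAt q d2
  have dC := hC.comp_hasFDerivAt q d2
  have dX : HasFDerivAt X _ q := ((d1.mul d2.cos).sub dA).prodMk (((d1.mul d2.sin).add dB).prodMk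
    ((d1.mul ((dB.mul d2.cos).add (dA.mul d2.sin))).add dC))
  have hsc := Real.sin_sq_add_cos_sq q.2
  rw [dX.fderiv]
  constructor
  · refine Prod.ext ?_ (Prod.ext ?_ ?_) <;> simp [X, frame1, frame2]
    ring
  · refine Prod.ext ?_ (Prod.ext ?_ ?_) <;> simp [X, frame1, frame2, frameT]
    · ring
    · ring
    · linear_combination (2 * q.1 * ζ + q.1 ^ 2) * hsc

/-- Here `P_x = 1`, so the rulings have angle `y`. The functions `A` and `B` integrate the planar
part of `∂X/∂y`, and `C` is chosen so that `Θ(∂X/∂y) = (x + ζ)² + η`. -/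
theorem exists_helicoid {I : Set ℝ} (hI : IsOpen I) (hc : I.OrdConnected) {ζ η : ℝ → ℝ}
    (hζ : ContDiffOn ℝ ∞ ζ I) (hη : ContDiffOn ℝ ∞ η I) {a b : ℝ} (hab : Set.Icc a b ⊆ I) :
    ∃ (N L : ℝ) (X : ℝ × ℝ → H1), 0 ≤ L ∧
      (∀ q ∈ strip a b N L, 0 < q.1 + ζ q.2 ∧ 0 < (q.1 + ζ q.2) ^ 2 + η q.2) ∧
      ContDiffOn ℝ ∞ X (strip a b N L) ∧
      Topology.IsEmbedding ((strip a b N L).domRestrict X) ∧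
      ∀ q ∈ strip a b N L,
        fderiv ℝ X q (1, 0) = Real.cos q.2 • frame1 (X q) + Real.sin q.2 • frame2 (X q) ∧
        fderiv ℝ X q (0, 1) = (q.1 + ζ q.2) • (Real.cos q.2 • frame2 (X q)
          - Real.sin q.2 • frame1 (X q)) + ((q.1 + ζ q.2) ^ 2 + η q.2) • frameT (X q) := by
  have hsin : ContDiffOn ℝ ∞ Real.sin I := Real.contDiff_sin.contDiffOn
  have hcos : ContDiffOn ℝ ∞ Real.cos I := Real.contDiff_cos.contDiffOn
  obtain ⟨A, hA, dA⟩ := exists_contDiffOn_antiderivative hI hc (hζ.mul hsin)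
  obtain ⟨B, hB, dB⟩ := exists_contDiffOn_antiderivative hI hc (hζ.mul hcos)
  obtain ⟨C, hC, dC⟩ := exists_contDiffOn_antiderivative hI hc
    (((hζ.pow 2).add hη).sub (hζ.mul ((hB.mul hsin).sub (hA.mul hcos))))
  -- Bounding the sum of the absolute values bounds `ζ`, `η`, `A` and `B` at once; the bound on `ζ`
  -- is also a Lipschitz constant for `A` and `B`.
  obtain ⟨M, hM⟩ := isCompact_Icc.exists_bound_of_continuousOn
    ((((hζ.continuousOn.abs.add hη.continuousOn.abs).add hA.continuousOn.abs).add
      hB.continuousOn.abs).mono hab)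
  set K := max 1 M
  have hK : 1 ≤ K := le_max_left _ _
  have hbd (y) (hy : y ∈ Set.Ioo a b) : |ζ y| ≤ K ∧ |η y| ≤ K ∧ |A y| ≤ K ∧ |B y| ≤ K := by
    have h := (le_abs_self _).trans ((hM y (Set.Ioo_subset_Icc_self hy)).trans (le_max_right 1 M))
    simp only [Pi.add_apply] at h
    have h1 := abs_nonneg (ζ y)
    have h2 := abs_nonneg (η y)
    have h3 := abs_nonneg (A y)
    have h4 := abs_nonneg (B y)
    refine ⟨?_, ?_, ?_, ?_⟩ <;> linarith
  have hUI : ∀ q ∈ strip a b (10 * K) (10 * K), q.2 ∈ I :=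
    fun q hq => hab (Set.Ioo_subset_Icc_self hq.1)
  let X : ℝ × ℝ → H1 := fun q => (q.1 * Real.cos q.2 - A q.2, q.1 * Real.sin q.2 + B q.2,
      q.1 * (B q.2 * Real.cos q.2 + A q.2 * Real.sin q.2) + C q.2)
  have hder (q) (hq : q ∈ strip a b (10 * K) (10 * K)) :=
    fderiv_helicoid (dA q.2 (hUI q hq)) (dB q.2 (hUI q hq)) (dC q.2 (hUI q hq))
  have hpos : ∀ q ∈ strip a b (10 * K) (10 * K),
      0 < q.1 + ζ q.2 ∧ 0 < (q.1 + ζ q.2) ^ 2 + η q.2 := by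
    intro q hq
    have h0 := (fst_lt_of_mem_strip (by linarith) hq).1
    obtain ⟨h1, h2, -, -⟩ := hbd q.2 hq.1
    have h1 := abs_le.1 h1
    have h2 := abs_le.1 h2
    have h3 : 9 * K ≤ q.1 + ζ q.2 := by linarith
    exact ⟨by linarith, by nlinarith⟩
  have hsm : ContDiffOn ℝ ∞ X (strip a b (10 * K) (10 * K)) := by
    have c2 : ContDiffOn ℝ ∞ (fun q : ℝ × ℝ => q.2) (strip a b (10 * K) (10 * K)) :=
      contDiff_snd.contDiffOn
    have c1 : ContDiffOn ℝ ∞ (fun q : ℝ × ℝ => q.1) (strip a b (10 * K) (10 * K)) :=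
      contDiff_fst.contDiffOn
    have cA := hA.comp c2 hUI
    have cB := hB.comp c2 hUI
    have cC := hC.comp c2 hUI
    exact ((c1.mul c2.cos).sub cA).prodMk (((c1.mul c2.sin).add cB).prodMk
      ((c1.mul ((cB.mul c2.cos).add (cA.mul c2.sin))).add cC))
  refine ⟨10 * K, 10 * K, X, by linarith, hpos, hsm, ?_, hder⟩
  refine isEmbedding_domRestrict_of_planar (isOpen_strip _ _ _ _) hsm ?_ fun q hq => ?_
  · have hI' {y} (hy : y ∈ Set.Ioo a b) : y ∈ I := hab (Set.Ioo_subset_Icc_self hy)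
    refine injOn_polar hK (fun y hy => (hbd y hy).2.2.1) (fun y hy => (hbd y hy).2.2.2)
      (abs_sub_le_of_hasDerivAt (fun y hy => dA y (hI' hy)) fun y hy => ?_)
      (abs_sub_le_of_hasDerivAt (fun y hy => dB y (hI' hy)) fun y hy => ?_)
    · rw [abs_mul]
      exact (mul_le_of_le_one_right (abs_nonneg _) (Real.abs_sin_le_one _)).trans (hbd y hy).1
    · rw [abs_mul]
      exact (mul_le_of_le_one_right (abs_nonneg _) (Real.abs_cos_le_one _)).trans (hbd y hy).1
  -- The planar Jacobian equals `P = x + ζ`, which is positive on the strip.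
  · rw [(hder q hq).1, (hder q hq).2]
    refine ne_of_eq_of_ne ?_ (hpos q hq).1.ne'
    simp [frame1, frame2, frameT]
    linear_combination (q.1 + ζ q.2) * Real.sin_sq_add_cos_sq q.2

/-- The analogue of `exists_helicoid` for parallel rulings. -/
theorem exists_parallel_ruled {I : Set ℝ} (hI : IsOpen I) (hc : I.OrdConnected) {ζ : ℝ → ℝ}
    (hζ : ContDiffOn ℝ ∞ ζ I) {a b : ℝ} (hab : Set.Icc a b ⊆ I) :
    ∃ (N : ℝ) (X : ℝ × ℝ → H1),
      (∀ q ∈ strip a b N 0, 0 < 2 * q.1 + ζ q.2) ∧ ContDiffOn ℝ ∞ X (strip a b N 0) ∧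
      Topology.IsEmbedding ((strip a b N 0).domRestrict X) ∧
      ∀ q ∈ strip a b N 0, fderiv ℝ X q (1, 0) = frame1 (X q) ∧
        fderiv ℝ X q (0, 1) = frame2 (X q) + (2 * q.1 + ζ q.2) • frameT (X q) := by
  obtain ⟨C, hC, dC⟩ := exists_contDiffOn_antiderivative hI hc hζ
  obtain ⟨M, hM⟩ := isCompact_Icc.exists_bound_of_continuousOn (hζ.continuousOn.mono hab)
  set K := max 1 M
  have hK : 1 ≤ K := le_max_left _ _
  have hUI : ∀ q ∈ strip a b K 0, q.2 ∈ I := fun q hq => hab (Set.Ioo_subset_Icc_self hq.1)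
  -- The angle is `0`, so the surface is a graph over the plane and no slant is needed.
  let X : ℝ × ℝ → H1 := fun q => (q.1, q.2, q.1 * q.2 + C q.2)
  have hder (q) (hq : q ∈ strip a b K 0) : fderiv ℝ X q (1, 0) = frame1 (X q) ∧
      fderiv ℝ X q (0, 1) = frame2 (X q) + (2 * q.1 + ζ q.2) • frameT (X q) := by
    have d1 : HasFDerivAt (fun q : ℝ × ℝ => q.1) (ContinuousLinearMap.fst ℝ ℝ ℝ) q :=
      hasFDerivAt_fst
    have d2 : HasFDerivAt (fun q : ℝ × ℝ => q.2) (ContinuousLinearMap.snd ℝ ℝ ℝ) q :=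
      hasFDerivAt_snd
    have dX : HasFDerivAt X _ q := d1.prodMk (d2.prodMk
      ((d1.mul d2).add ((dC q.2 (hUI q hq)).comp_hasFDerivAt q d2)))
    rw [dX.fderiv]
    constructor
    · simp [X, frame1]
    · refine Prod.ext ?_ (Prod.ext ?_ ?_) <;> simp [X, frame2, frameT]
      ring
  have hsm : ContDiffOn ℝ ∞ X (strip a b K 0) :=
    contDiff_fst.contDiffOn.prodMk (contDiff_snd.contDiffOn.prodMk
      ((contDiff_fst.mul contDiff_snd).contDiffOn.add (hC.comp contDiff_snd.contDiffOn hUI)))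
  refine ⟨K, X, fun q hq => ?_, hsm, ?_, hder⟩
  · have h0 := (fst_lt_of_mem_strip le_rfl hq).1
    have h1 := (abs_le.1 ((hM q.2 (Set.Ioo_subset_Icc_self hq.1)).trans (le_max_right 1 M))).1
    linarith
  · refine isEmbedding_domRestrict_of_planar (isOpen_strip _ _ _ _) hsm (fun p _ q _ h => h)
      fun q hq => ?_
    rw [(hder q hq).1, (hder q hq).2]
    simp [frame1, frame2, frameT]

theorem exists_isNormalSurface (τ : SurfaceType) {I : Set ℝ} (hI : IsOpen I) (hc : I.OrdConnected)
    {ζ₁ ζ₂ : ℝ → ℝ} (hζ₁ : ContDiffOn ℝ ∞ ζ₁ I) (hζ₂ : ContDiffOn ℝ ∞ ζ₂ I) {a b : ℝ}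
    (hab : Set.Icc a b ⊆ I) :
    ∃ (N L : ℝ) (X : ℝ × ℝ → H1), 0 ≤ L ∧ IsNormalSurface τ ζ₁ ζ₂ (strip a b N L) X := by
  cases τ with
  | specialI =>
    obtain ⟨N, L, X, hL, hpos, hsm, hemb, hder⟩ :=
      -- Type I is the helicoid with `η = 0`: then `R = (x + ζ₁)²` and `P / R = 1 / (x + ζ₁)`.
      exists_helicoid hI hc hζ₁ (contDiffOn_const (c := (0 : ℝ))) hab
    refine ⟨N, L, X, hL, isNormalSurface_of_fderiv 1 hsm hemb
      (fun q hq => by simpa using (hder q hq).1) (fun q hq => by simpa using (hder q hq).2)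
      (fun q hq => (hpos q hq).1.ne' |> pow_ne_zero 2) (fun q hq => (hpos q hq).1.ne')
      (fun q hq => ?_) fun q hq => ?_⟩
    · have := (hpos q hq).1.ne'
      simp only [SurfaceType.alpha]
      field_simp
    · have := (hpos q hq).1.ne'
      simp only [SurfaceType.normalB, SurfaceType.alpha]
      rw [div_pow, one_pow, div_div]
  | specialII =>
    obtain ⟨N, X, hpos, hsm, hemb, hder⟩ := exists_parallel_ruled hI hc hζ₁ hab
    refine ⟨N, 0, X, le_rfl, isNormalSurface_of_fderiv (P := fun _ => 1) 0 hsm hemb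
      (fun q hq => by simpa using (hder q hq).1) (fun q hq => by simpa using (hder q hq).2)
      (fun q hq => (hpos q hq).ne') (fun q hq => (hpos q hq).ne') (fun q hq => rfl) fun q hq => ?_⟩
    simp only [SurfaceType.normalB, SurfaceType.alpha]
    rw [abs_of_pos (one_div_pos.2 (hpos q hq)), div_div]
  | general =>
    obtain ⟨N, L, X, hL, hpos, hsm, hemb, hder⟩ := exists_helicoid hI hc hζ₁ hζ₂ hab
    refine ⟨N, L, X, hL, isNormalSurface_of_fderiv 1 hsm hemb
      (fun q hq => by simpa using (hder q hq).1) (fun q hq => by simpa using (hder q hq).2)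
      (fun q hq => (hpos q hq).2.ne') (fun q hq => (hpos q hq).2.ne') (fun q hq => rfl)
      fun q hq => ?_⟩
    simp only [SurfaceType.normalB]
    rw [abs_of_pos (hpos q hq).2]

end Heisenberg

/-! ### The theorem -/

theorem theorem1p6 (c d : EReal) (hcd : c < d) (ζ₁ ζ₂ : ℝ → ℝ)
    (hζ₁ : ContDiffOn ℝ ∞ ζ₁ (Heisenberg.interval c d))
    (hζ₂ : ContDiffOn ℝ ∞ ζ₂ (Heisenberg.interval c d))
    (hne : ∀ y ∈ Heisenberg.interval c d, ζ₂ y ≠ 0) :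
    -- existence, for each of the three types, over any compact subinterval
    (∀ (τ : Heisenberg.SurfaceType) (c' d' : ℝ), c' ≤ d' →
      Set.Icc c' d' ⊆ Heisenberg.interval c d →
      ∃ (e f : ℝ) (U : Set (ℝ × ℝ)) (X : ℝ × ℝ → Heisenberg.H1),
        IsOpen U ∧ IsConnected U ∧ U ⊆ Set.Ioo e f ×ˢ Heisenberg.interval c d ∧
        Set.Icc c' d' ⊆ Prod.snd '' U ∧ Heisenberg.IsNormalSurface τ ζ₁ ζ₂ U X) ∧
    -- uniqueness up to a Heisenberg rigid motion
    (∀ (τ : Heisenberg.SurfaceType) (U : Set (ℝ × ℝ)) (X Y : ℝ × ℝ → Heisenberg.H1),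
      IsOpen U → IsConnected U → U ⊆ Set.univ ×ˢ Heisenberg.interval c d →
      Heisenberg.IsNormalSurface τ ζ₁ ζ₂ U X → Heisenberg.IsNormalSurface τ ζ₁ ζ₂ U Y →
      ∃ Φ : Heisenberg.H1 ≃ Heisenberg.H1, Heisenberg.IsRigidMotion Φ ∧ ∀ q ∈ U, Y q = Φ (X q)) := by
  refine ⟨fun τ c' d' hcd' hsub => ?_,
    fun τ U X Y hU hconn _ hX hY => hX.exists_isRigidMotion hU hconn hY⟩
  have hI := Heisenberg.isOpen_interval c d
  have hc := Heisenberg.ordConnected_interval c d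
  obtain ⟨a, ha, b, hb, hab⟩ := Heisenberg.exists_Icc_subset_of_isOpen hI hc hcd' hsub
  obtain ⟨N, L, X, hL, hX⟩ := Heisenberg.exists_isNormalSurface τ hI hc hζ₁ hζ₂ hab
  refine ⟨N, N + 1 + L * (b - a), Heisenberg.strip a b N L, X, Heisenberg.isOpen_strip a b N L,
    Heisenberg.isConnected_strip (by linarith) N L, fun q hq =>
      ⟨Heisenberg.fst_lt_of_mem_strip hL hq, hab (Set.Ioo_subset_Icc_self hq.1)⟩, ?_, hX⟩
  rw [Heisenberg.snd_image_strip]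
  exact Set.Icc_subset_Ioo ha hb
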